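/- Let $\Omega\subset\mathbb R^2$ be an open set (e.g. a bounded Lipschitz domain) and let $\mathcal T_h$ be a conforming triangular mesh of $\Omega$, i.e. a finite set of nondegenerate closed triangles whose union is $\overline\Omega$, any two of which are disjoint or meet exactly in a common vertex or a common edge or coincide. Let $\mathcal F_h$ be the set of all edges (internal and boundary) of the mesh. For an edge $F$ of $K\in\mathcal T_h$, let $\lambda_{K,F}$ be the barycentric coordinate of $K$ at the vertex opposite to $F$ (affine, equal to $1$ at that vertex and $0$ on $F$). Let $L_j$ be the Legendre polynomial of degree $j$ on $[-1,1]$ with $L_j(1)=1$. Fix an ordering of the two endpoints of every edge and a numbering of the three vertices of every triangle. All functions below are regarded as elements of $L^2(\Omega)$. * For $F\in\mathcal F_h$, the linear edge nonconforming bubble is $b_1^F:=L_1(1-2\lambda_{K,F})=1-2\lambda_{K,F}$ on every $K\in\mathcal T_h$ having $F$ as an edge, and $b_1^F:=0$ on all other triangles. * For $F\in\mathcal F_h$ and $j\ge 1$, the modal edge function $\varphi_j^F$ is $$\varphi_j^F:=\frac{8\sqrt{4j+2}}{j(j+1)}\,\lambda_{a}\lambda_{b}\,L_j'(-\lambda_{a}+\lambda_{b})$$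 on every $K$ having $F$ as an edge, where $\lambda_a,\lambda_b$ are the barycentric coordinates of $K$ at the first and the second endpoint of $F$, and $\varphi_j^F:=0$ on all other triangles. * For $K\in\mathcal T_h$ and integers $r_1,r_2\ge 0$, the modal element bubble $\varphi_{r_1,r_2}^K$ is $$\varphi_{r_1,r_2}^K:=\lambda_1\lambda_2\lambda_3\,L_{r_1}(\lambda_2-\lambda_1)\,L_{r_2}(2\lambda_3-1)$$ on $K$, where $\lambda_i$ is the barycentric coordinate of $K$ at its $i$-th vertex, and $\varphi_{r_1,r_2}^K:=0$ on all other triangles. Let $\mathbf p=(p_K)_{K\in\mathcal T_h}$ be an arbitrary distribution of polynomial degrees $p_K\in\mathbb N$, and for $F\in\mathcal F_h$ let $p_F$ be the maximum of $p_K$ over the (one or two) triangles $K$ having $F$ as an edge. The variable-order Crouzeix--Raviart space is $$\widetilde V_n^{\rm ex}:=\operatorname{span}\Big(b_1^F,\ \varphi_j^F\ (1\le j\le p_F-1)\ \ \forall F\in\mathcal F_h;\quad \varphi_{r_1,r_2}^K\ (r_1,r_2\ge0,\ r_1+r_2\le p_K-3)\ \ \forall K\in\mathcal T_h\Big)\subset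 L^2(\Omega).$$ Then the family of functions in this span is linearly independent; hence it is a basis of $\widetilde V_n^{\rm ex}$. -/

import Mathlib

open MeasureTheory Polynomial

noncomputable section

namespace CR

/-- The Euclidean plane. -/
abbrev Plane : Type := EuclideanSpace ℝ (Fin 2)

/-- The Legendre polynomial of degree `n` on `[-1, 1]` (Rodrigues' formula; its value at `1`
is `1`). -/
def legendre (n : ℕ) : ℝ[X] :=
  C ((2 ^ n * (n.factorial : ℝ))⁻¹) * derivative^[n] ((X ^ 2 - 1) ^ n)

/-- A conforming triangular mesh of `Ω`: a finite geometric simplicial complex in the plane, all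
of whose faces are faces of triangles, and which covers exactly the closure of `Ω`. -/
structure Mesh (Ω : Set Plane) where
  /-- the simplicial complex of all vertices, edges and triangles -/
  complex : Geometry.SimplicialComplex ℝ Plane
  finite_faces : complex.faces.Finite
  pure : ∀ s ∈ complex.faces, ∃ t ∈ complex.faces, s ⊆ t ∧ t.card = 3
  space_eq : complex.space = closure Ω

namespace Mesh

variable {Ω : Set Plane} (M : Mesh Ω)

/-- The elements (triangles) of the mesh, given by their vertex sets. -/
def Element : Type := {K : Finset Plane // K ∈ M.complex.faces ∧ K.card = 3}

/-- The edges of the mesh, internal and boundary ones, given by their sets of endpoints. -/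
def Edge : Type := {F : Finset Plane // F ∈ M.complex.faces ∧ F.card = 2}

instance : Finite M.Element := (M.finite_faces.subset fun _ hK => hK.1).to_subtype

instance : Fintype M.Element := Fintype.ofFinite _

/-- The closed triangle spanned by the vertices of `K`. -/
def triangle (K : M.Element) : Set Plane := convexHull ℝ (K.1 : Set Plane)

/-- The vertices of an element form an affine basis of the plane. -/
def affineBasis (K : M.Element) : AffineBasis K.1 ℝ Plane where
  toFun := (↑)
  ind' := M.complex.indep K.2.1
  tot' := by
    rw [(M.complex.indep K.2.1).affineSpan_eq_top_iff_card_eq_finrank_add_one]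
    simp [K.2.2]

/-- The barycentric coordinate of the element `K` at its vertex `v`: the affine function that
is `1` at `v` and `0` at the other two vertices. -/
def bary (K : M.Element) (v : K.1) : Plane → ℝ := (M.affineBasis K).coord v

theorem continuous_bary (K : M.Element) (v : K.1) : Continuous (M.bary K v) :=
  ((M.affineBasis K).coord v).continuous_of_finiteDimensional

open Classical in
/-- The barycentric coordinate `λ_{K,F}` of `K` at the vertex opposite to its edge `F`. The sum
has exactly one term if `F` is an edge of `K`. -/
def baryOpp (K : M.Element) (F : M.Edge) (x : Plane) : ℝ :=
  ∑ v : K.1, if v.1 ∈ F.1 then 0 else M.bary K v x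

theorem continuous_baryOpp (K : M.Element) (F : M.Edge) : Continuous (M.baryOpp K F) := by
  refine continuous_finsetSum _ fun v _ => ?_
  split_ifs
  · exact continuous_const
  · exact M.continuous_bary K v

/-- The function on the plane that equals `g K` inside each element `K` and `0` elsewhere, in
particular on the edges of the mesh, which form a null set. -/
def broken (g : M.Element → Plane → ℝ) (x : Plane) : ℝ :=
  ∑ K : M.Element, (interior (M.triangle K)).indicator (g K) x

theorem memLp_broken {g : M.Element → Plane → ℝ} (hg : ∀ K, Continuous (g K)) :
    MemLp (M.broken g) 2 (volume.restrict Ω) := by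
  refine MemLp.restrict Ω (memLp_finsetSum _ fun K _ => ?_)
  have hc : IsCompact (M.triangle K) := K.1.finite_toSet.isCompact_convexHull (𝕜 := ℝ)
  rw [memLp_indicator_iff_restrict isOpen_interior.measurableSet]
  refine MemLp.mono_measure (Measure.restrict_mono interior_subset le_rfl) ?_
  obtain ⟨B, hB⟩ := hc.exists_bound_of_continuousOn (hg K).continuousOn
  have : IsFiniteMeasure (volume.restrict (M.triangle K)) :=
    isFiniteMeasure_restrict.2 hc.measure_lt_top.ne
  exact MemLp.of_bound (hg K).aestronglyMeasurable B
    ((ae_restrict_iff' hc.measurableSet).2 (.of_forall hB))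

/-- The element of `L²(Ω)` whose restriction to each element `K` of the mesh is `g K`. -/
def brokenLp (g : M.Element → Plane → ℝ) (hg : ∀ K, Continuous (g K)) :
    Lp ℝ 2 (volume.restrict Ω) :=
  (M.memLp_broken hg).toLp _

open Classical in
/-- The restriction to `K` of the edge nonconforming bubble of degree `p` of the edge `F`. -/
def ncBubbleLocal (p : ℕ) (F : M.Edge) (K : M.Element) (x : Plane) : ℝ :=
  if F.1 ⊆ K.1 then (legendre p).eval (1 - 2 * M.baryOpp K F x) else 0

theorem continuous_ncBubbleLocal (p : ℕ) (F : M.Edge) (K : M.Element) :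
    Continuous (M.ncBubbleLocal p F K) := by
  unfold ncBubbleLocal
  split_ifs
  · have := M.continuous_baryOpp K F
    exact (legendre p).continuous.comp (by fun_prop)
  · exact continuous_const

/-- The edge nonconforming bubble `b_p^F`, equal to `L_p(1 - 2 λ_{K,F})` on each of the elements
`K` with edge `F`, and to `0` on all other elements. -/
def ncBubble (p : ℕ) (F : M.Edge) : Lp ℝ 2 (volume.restrict Ω) :=
  M.brokenLp (M.ncBubbleLocal p F) (M.continuous_ncBubbleLocal p F)

/-- A choice of the first and the second endpoint of each edge. -/
abbrev EdgeOrientation : Type := (F : M.Edge) → Fin 2 ≃ F.1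

/-- A numbering of the vertices of each element, that is, a choice of the affine map from the
reference triangle onto each element. -/
abbrev VertexNumbering : Type := (K : M.Element) → Fin 3 ≃ K.1

open Classical in
/-- The restriction to `K` of the `j`-th modal edge function of the edge `F`. -/
def modalEdgeLocal (o : M.EdgeOrientation) (F : M.Edge) (j : ℕ) (K : M.Element) (x : Plane) : ℝ :=
  if h : F.1 ⊆ K.1 then
    8 * √(4 * j + 2) / (j * (j + 1))
      * M.bary K ⟨o F 0, h (o F 0).2⟩ x * M.bary K ⟨o F 1, h (o F 1).2⟩ x
      * (derivative (legendre j)).eval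
          (-M.bary K ⟨o F 0, h (o F 0).2⟩ x + M.bary K ⟨o F 1, h (o F 1).2⟩ x)
  else 0

theorem continuous_modalEdgeLocal (o : M.EdgeOrientation) (F : M.Edge) (j : ℕ) (K : M.Element) :
    Continuous (M.modalEdgeLocal o F j K) := by
  unfold modalEdgeLocal
  split_ifs with h
  · have h0 := M.continuous_bary K ⟨o F 0, h (o F 0).2⟩
    have h1 := M.continuous_bary K ⟨o F 1, h (o F 1).2⟩
    exact (by fun_prop : Continuous _).mul
      ((derivative (legendre j)).continuous.comp (by fun_prop))
  · exact continuous_const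

/-- The modal edge function `φ_j^F`, `j ≥ 1`. On each element with edge `F` it is the image of
the reference edge function; the orientation of `F` is the same on both sides of `F`. -/
def modalEdge (o : M.EdgeOrientation) (F : M.Edge) (j : ℕ) : Lp ℝ 2 (volume.restrict Ω) :=
  M.brokenLp (M.modalEdgeLocal o F j) (M.continuous_modalEdgeLocal o F j)

open Classical in
/-- The restriction to `T` of the modal element bubble with indices `r₁, r₂` of the element
`K`. -/
def modalElementLocal (ν : M.VertexNumbering) (K : M.Element) (r₁ r₂ : ℕ) (T : M.Element)
    (x : Plane) : ℝ :=
  if T = K then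
    M.bary K (ν K 0) x * M.bary K (ν K 1) x * M.bary K (ν K 2) x
      * (legendre r₁).eval (M.bary K (ν K 1) x - M.bary K (ν K 0) x)
      * (legendre r₂).eval (2 * M.bary K (ν K 2) x - 1)
  else 0

theorem continuous_modalElementLocal (ν : M.VertexNumbering) (K : M.Element) (r₁ r₂ : ℕ)
    (T : M.Element) : Continuous (M.modalElementLocal ν K r₁ r₂ T) := by
  unfold modalElementLocal
  have h0 := M.continuous_bary K (ν K 0)
  have h1 := M.continuous_bary K (ν K 1)
  have h2 := M.continuous_bary K (ν K 2)
  split_ifs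
  · exact ((by fun_prop : Continuous _).mul ((legendre r₁).continuous.comp (by fun_prop))).mul
      ((legendre r₂).continuous.comp (by fun_prop))
  · exact continuous_const

/-- The modal element bubble `φ_{r₁,r₂}^K`, which vanishes outside `K`. -/
def modalElement (ν : M.VertexNumbering) (K : M.Element) (r₁ r₂ : ℕ) :
    Lp ℝ 2 (volume.restrict Ω) :=
  M.brokenLp (M.modalElementLocal ν K r₁ r₂) (M.continuous_modalElementLocal ν K r₁ r₂)

open Classical in
/-- The degree `p_F` of an edge: the maximum of the degrees of the (one or two) elements that
have `F` as an edge. -/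
def edgeDegree (p : M.Element → ℕ) (F : M.Edge) : ℕ :=
  {K : M.Element | F.1 ⊆ K.1}.toFinset.sup p

/-- The indices of the functions that span the variable order space with degrees `p`: one linear
bubble per edge, the modal edge functions with `1 ≤ j ≤ p_F - 1`, and the modal element bubbles
with `r₁ + r₂ ≤ p_K - 3`. -/
inductive SpanIndex (p : M.Element → ℕ) : Type
  | ncBubble (F : M.Edge) : SpanIndex p
  | modalEdge (F : M.Edge) (j : ℕ) (one_le : 1 ≤ j) (le : j + 1 ≤ M.edgeDegree p F) : SpanIndex p
  | modalElement (K : M.Element) (r₁ r₂ : ℕ) (le : r₁ + r₂ + 3 ≤ p K) : SpanIndex p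

/-- The functions that span the variable order space with degrees `p`. -/
def spanFamily (o : M.EdgeOrientation) (ν : M.VertexNumbering) (p : M.Element → ℕ) :
    M.SpanIndex p → Lp ℝ 2 (volume.restrict Ω)
  | .ncBubble F => M.ncBubble 1 F
  | .modalEdge F j _ _ => M.modalEdge o F j
  | .modalElement K r₁ r₂ _ => M.modalElement ν K r₁ r₂

/-- The (explicit) variable order Crouzeix-Raviart space with degrees `p`. -/
def variableCRSpace (o : M.EdgeOrientation) (ν : M.VertexNumbering) (p : M.Element → ℕ) :
    Submodule ℝ (Lp ℝ 2 (volume.restrict Ω)) :=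
  Submodule.span ℝ (Set.range (M.spanFamily o ν p))

end Mesh

end CR

end

noncomputable section

namespace CR

/-! A vanishing combination in L²(Ω) vanishes pointwise on every closed triangle
(`eqOn_zero_of_brokenLp_eq_zero`), and the three families then separate by where they vanish. At a
vertex only the linear bubbles survive. With S the sum of the coefficients over the edges of K, they
give S - 2a = 0 for each edge, which forces S = 0 and a = 0 (`ncBubble_coeff_eq_zero`). On an edge F
of K, the element bubbles and the modal functions of the other edges vanish. Dividing by λ_a λ_b
leaves a combination of the L_j', which have distinct degrees (`modalEdge_coeff_eq_zero`). Inside K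
only its element bubbles remain. Dividing by λ₁λ₂λ₃ leaves products of Legendre polynomials in two
independent variables (`modalElement_coeff_eq_zero`). -/

/-! ### Independence of Legendre polynomials, their derivatives and their products. -/

theorem degree_legendre (n : ℕ) : (legendre n).degree = n := by
  have hm : ((X ^ 2 - 1 : ℝ[X]) ^ n).Monic := (monic_X_pow_sub_C (1 : ℝ) two_ne_zero).pow n
  have hd : ((X ^ 2 - 1 : ℝ[X]) ^ n).natDegree = n + n := by
    rw [natDegree_pow, show (X ^ 2 - 1 : ℝ[X]) = X ^ 2 - C 1 by simp, natDegree_X_pow_sub_C,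
      mul_two]
  have hc : (2 ^ n * (n.factorial : ℝ))⁻¹ ≠ 0 := by positivity
  rw [legendre, degree_C_mul hc]
  refine degree_eq_of_le_of_coeff_ne_zero (degree_le_of_natDegree_le ?_) ?_
  · exact (natDegree_iterate_derivative _ _).trans (by omega)
  · rw [coeff_iterate_derivative, ← hd, hm.coeff_natDegree, hd, nsmul_one, Nat.cast_ne_zero]
    exact (Nat.descFactorial_pos.2 (by omega)).ne'

theorem linearIndependent_legendre : LinearIndependent ℝ legendre :=
  Polynomial.Sequence.linearIndependent ⟨legendre, degree_legendre⟩

/-- The shift skips L_0' = 0, so that the n-th entry has degree exactly n. -/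
theorem linearIndependent_derivative_legendre :
    LinearIndependent ℝ fun n => derivative (legendre (n + 1)) := by
  refine Polynomial.Sequence.linearIndependent ⟨fun n => derivative (legendre (n + 1)), fun n => ?_⟩
  have h := natDegree_eq_of_degree_eq_some (degree_legendre (n + 1))
  rw [degree_derivative (by omega), h, Nat.add_sub_cancel]

theorem eval_legendre_one (x : ℝ) : (legendre 1).eval x = x := by
  simp [legendre]
  ring

/-- A linear combination of linearly independent polynomials that vanishes at infinitely many
points is trivial. -/
theorem eq_zero_of_sum_mul_eval_eq_zero {ι : Type*} [Fintype ι] {P : ι → ℝ[X]}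
    (hP : LinearIndependent ℝ P) {c : ι → ℝ} {s : Set ℝ} (hs : s.Infinite)
    (h : ∀ x ∈ s, ∑ i, c i * (P i).eval x = 0) (i : ι) : c i = 0 := by
  refine Fintype.linearIndependent_iff.1 hP c (eq_zero_of_infinite_isRoot _ (hs.mono ?_)) i
  intro x hx
  simpa [IsRoot, eval_finsetSum] using h x hx

/-- The products of Legendre polynomials in two independent variables are linearly independent
as functions on the triangle `|t| < 1 - s`, `0 < s < 1`. -/
theorem eq_zero_of_sum_mul_legendre_mul_legendre {n : ℕ} {c : Fin n → Fin n → ℝ}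
    (h : ∀ s ∈ Set.Ioo (0 : ℝ) 1, ∀ t ∈ Set.Ioo (-(1 - s)) (1 - s),
      ∑ i, ∑ j, c i j * ((legendre i).eval t * (legendre j).eval (2 * s - 1)) = 0)
    (i j : Fin n) : c i j = 0 := by
  have hL : LinearIndependent ℝ fun i : Fin n => legendre i :=
    linearIndependent_legendre.comp _ Fin.val_injective
  -- One variable at a time: for fixed x = 2s - 1, independence in t kills the coefficient of each
  -- L_i(t). That coefficient is itself a Legendre combination in x vanishing on (-1, 1).
  refine eq_zero_of_sum_mul_eval_eq_zero hL (c := c i) (s := Set.Ioo (-1) 1)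
    (Set.Ioo_infinite (by norm_num)) (fun x hx => ?_) j
  refine eq_zero_of_sum_mul_eval_eq_zero hL (c := fun i => ∑ j, c i j * (legendre j).eval x)
    (s := Set.Ioo (-(1 - (x + 1) / 2)) (1 - (x + 1) / 2))
    (Set.Ioo_infinite (by linarith [hx.2])) (fun t ht => ?_) i
  rw [← h ((x + 1) / 2) ⟨by linarith [hx.1], by linarith [hx.2]⟩ t ht]
  simp_rw [Finset.sum_mul]
  refine Finset.sum_congr rfl fun i _ => Finset.sum_congr rfl fun j _ => ?_
  rw [show 2 * ((x + 1) / 2) - 1 = x by ring]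
  ring

namespace Mesh

variable {Ω : Set Plane} (M : Mesh Ω)

/-! ### Triangles in barycentric coordinates. -/

theorem range_affineBasis (K : M.Element) : Set.range (M.affineBasis K) = (K.1 : Set Plane) :=
  Subtype.range_coe

theorem mem_triangle_iff {K : M.Element} {x : Plane} :
    x ∈ M.triangle K ↔ ∀ v, 0 ≤ M.bary K v x := by
  rw [triangle, ← M.range_affineBasis, AffineBasis.convexHull_eq_nonneg_coord]
  rfl

theorem mem_interior_triangle_iff {K : M.Element} {x : Plane} :
    x ∈ interior (M.triangle K) ↔ ∀ v, 0 < M.bary K v x := by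
  rw [triangle, ← M.range_affineBasis, AffineBasis.interior_convexHull]
  rfl

/-- Points of the plane with prescribed barycentric coordinates exist. -/
theorem exists_bary_eq (K : M.Element) {w : K.1 → ℝ} (hw : ∑ v, w v = 1) :
    ∃ x, ∀ v, M.bary K v x = w v :=
  ⟨Finset.univ.affineCombination ℝ (M.affineBasis K) w, fun v =>
    (M.affineBasis K).coord_apply_combination_of_mem (Finset.mem_univ v) hw⟩

theorem isClosed_triangle (K : M.Element) : IsClosed (M.triangle K) :=
  (K.1.finite_toSet.isCompact_convexHull (𝕜 := ℝ)).isClosed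

theorem closure_interior_triangle (K : M.Element) :
    closure (interior (M.triangle K)) = M.triangle K := by
  have h := (M.affineBasis K).centroid_mem_interior_convexHull
  rw [M.range_affineBasis] at h
  exact ((convex_convexHull ℝ _).closure_interior_eq_closure_of_nonempty_interior ⟨_, h⟩).trans
    (M.isClosed_triangle K).closure_eq

/-- Different elements of the mesh have disjoint interiors. -/
theorem disjoint_interior_triangle {K T : M.Element} (h : K ≠ T) :
    Disjoint (interior (M.triangle K)) (interior (M.triangle T)) := by
  rw [Set.disjoint_left]
  intro x hxK hxT
  obtain ⟨v, hvK, hvT⟩ : ∃ v ∈ K.1, v ∉ T.1 := by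
    by_contra! hsub
    exact h (Subtype.ext (Finset.eq_of_subset_of_card_le hsub (by rw [K.2.2, T.2.2])))
  -- A common point lies in the hull of the shared vertices, where the coordinate of K at the
  -- unshared vertex v is 0; in the interior of K it is positive.
  have hx : x ∈ convexHull ℝ (K.1 ∩ T.1 : Set Plane) :=
    M.complex.inter_subset_convexHull K.2.1 T.2.1 ⟨interior_subset hxK, interior_subset hxT⟩
  have hle : convexHull ℝ (K.1 ∩ T.1 : Set Plane) ⊆
      (M.affineBasis K).coord ⟨v, hvK⟩ ⁻¹' {0} := by
    refine convexHull_min ?_ ((convex_singleton (𝕜 := ℝ) (0 : ℝ)).affine_preimage _)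
    rintro u ⟨huK, huT⟩
    have hne : v ≠ u := fun heq => hvT (heq ▸ huT)
    exact (M.affineBasis K).coord_apply_ne (j := ⟨u, huK⟩) fun heq => hne (congrArg Subtype.val heq)
  exact (M.mem_interior_triangle_iff.1 hxK ⟨v, hvK⟩).ne' (hle hx)

/-! ### From equality in L²(Ω) to pointwise equality on elements. -/

theorem broken_apply_of_mem_interior (g : M.Element → Plane → ℝ) {K : M.Element} {x : Plane}
    (hx : x ∈ interior (M.triangle K)) : M.broken g x = g K x := by
  rw [broken, Finset.sum_eq_single K, Set.indicator_of_mem hx]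
  · intro T _ hT
    exact Set.indicator_of_notMem
      (fun hxT => Set.disjoint_left.1 (M.disjoint_interior_triangle hT) hxT hx) _
  · simp

/-- If an element-wise continuous function vanishes in `L²(Ω)`, then it vanishes on every
element. -/
theorem eqOn_zero_of_brokenLp_eq_zero (hΩ : IsOpen Ω) {g : M.Element → Plane → ℝ}
    (hg : ∀ K, Continuous (g K)) (h : M.brokenLp g hg = 0) (K : M.Element) :
    ∀ x ∈ M.triangle K, g K x = 0 := by
  have hae : M.broken g =ᵐ[volume.restrict Ω] 0 :=
    (M.memLp_broken hg).coeFn_toLp.symm.trans (Lp.eq_zero_iff_ae_eq_zero.1 h)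
  set U := interior (M.triangle K) ∩ Ω
  have hU : IsOpen U := isOpen_interior.inter hΩ
  have hgU : g K =ᵐ[volume.restrict U] 0 := by
    filter_upwards [ae_restrict_of_ae_restrict_of_subset Set.inter_subset_right hae,
      ae_restrict_mem hU.measurableSet] with x hx hxU
    rwa [M.broken_apply_of_mem_interior g hxU.1] at hx
  have hzero : Set.EqOn (g K) 0 U :=
    Measure.eqOn_open_of_ae_eq hgU hU (hg K).continuousOn continuousOn_const
  -- Ω itself may miss points of K, but K lies in its closure, so the open set U is dense in K and
  -- continuity does the rest.
  have hsub : M.triangle K ⊆ closure U := by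
    rw [← M.closure_interior_triangle K]
    refine closure_minimal (fun x hx => ?_) isClosed_closure
    refine isOpen_interior.inter_closure ⟨hx, ?_⟩
    rw [← M.space_eq]
    exact M.complex.convexHull_subset_space K.2.1 (interior_subset hx)
  intro x hx
  exact (hzero.closure (hg K) continuous_zero) (hsub hx)

/-- The linear map that sends a family of continuous functions, one for each element, to the
element of `L²(Ω)` composed of them. -/
def brokenLinearMap : (M.Element → C(Plane, ℝ)) →ₗ[ℝ] Lp ℝ 2 (volume.restrict Ω) where
  toFun g := M.brokenLp (fun K => g K) fun K => (g K).continuous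
  map_add' f g := by
    rw [brokenLp, brokenLp, brokenLp, ← MemLp.toLp_add]
    congr 1
    ext x
    simp only [broken, Pi.add_apply, ← Finset.sum_add_distrib]
    exact Finset.sum_congr rfl fun K _ => congrFun (Set.indicator_add _ (f K) (g K)) x
  map_smul' c f := by
    rw [brokenLp, brokenLp, RingHom.id_apply, ← MemLp.toLp_const_smul]
    congr 1
    ext x
    simp only [broken, Pi.smul_apply, Finset.smul_sum]
    exact Finset.sum_congr rfl fun K _ => congrFun (Set.indicator_const_smul _ c (f K)) x

theorem brokenLinearMap_eq_zero (hΩ : IsOpen Ω) {g : M.Element → C(Plane, ℝ)}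
    (h : M.brokenLinearMap g = 0) (K : M.Element) {x : Plane} (hx : x ∈ M.triangle K) :
    g K x = 0 :=
  M.eqOn_zero_of_brokenLp_eq_zero hΩ (fun K => (g K).continuous) h K x hx

/-! ### Finite indexing of the family and its local representatives. -/

instance : Finite M.Edge := (M.finite_faces.subset fun _ hF => hF.1).to_subtype

instance : Fintype M.Edge := Fintype.ofFinite _

/-- The degrees of the modal edge functions of the edge `F`. -/
abbrev EdgeModes (p : M.Element → ℕ) (F : M.Edge) : Type :=
  {j : Fin (M.edgeDegree p F) // 1 ≤ (j : ℕ)}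

/-- The degrees of the modal element bubbles of the element `K`. -/
abbrev ElementModes (p : M.Element → ℕ) (K : M.Element) : Type :=
  {r : Fin (p K) × Fin (p K) // (r.1 : ℕ) + r.2 + 3 ≤ p K}

/-- The index type of the spanning family as a sum of its three parts. -/
def spanIndexEquiv (p : M.Element → ℕ) :
    (M.Edge ⊕ (Σ F, M.EdgeModes p F)) ⊕ (Σ K, M.ElementModes p K) ≃ M.SpanIndex p where
  toFun
    | .inl (.inl F) => .ncBubble F
    | .inl (.inr ⟨F, j⟩) => .modalEdge F j.1 j.2 j.1.2
    | .inr ⟨K, r⟩ => .modalElement K r.1.1 r.1.2 r.2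
  invFun
    | .ncBubble F => .inl (.inl F)
    | .modalEdge F j h₁ h => .inl (.inr ⟨F, ⟨⟨j, h⟩, h₁⟩⟩)
    | .modalElement K r₁ r₂ h =>
      .inr ⟨K, ⟨(⟨r₁, by omega⟩, ⟨r₂, by omega⟩), h⟩⟩
  left_inv := by rintro ((F | ⟨F, j⟩) | ⟨K, r⟩) <;> rfl
  right_inv := by rintro (F | _ | _) <;> rfl

/-- The restrictions to the elements of the functions of the spanning family. -/
def spanLocal (o : M.EdgeOrientation) (ν : M.VertexNumbering) (p : M.Element → ℕ) :
    M.SpanIndex p → M.Element → C(Plane, ℝ)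
  | .ncBubble F, K => ⟨_, M.continuous_ncBubbleLocal 1 F K⟩
  | .modalEdge F j _ _, K => ⟨_, M.continuous_modalEdgeLocal o F j K⟩
  | .modalElement T r₁ r₂ _, K => ⟨_, M.continuous_modalElementLocal ν T r₁ r₂ K⟩

theorem brokenLinearMap_spanLocal (o : M.EdgeOrientation) (ν : M.VertexNumbering)
    (p : M.Element → ℕ) (i : M.SpanIndex p) :
    M.brokenLinearMap (M.spanLocal o ν p i) = M.spanFamily o ν p i := by
  cases i <;> rfl

/-! ### Edges of an element and the vanishing of the local functions. -/

theorem bary_vertex (K : M.Element) (u v : K.1) [Decidable (u = v)] :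
    M.bary K u v = if u = v then 1 else 0 := by
  classical
  have h := (M.affineBasis K).coord_apply u v
  rw [bary]
  convert h
  rfl

theorem vertex_mem_triangle (K : M.Element) (v : K.1) : (v : Plane) ∈ M.triangle K :=
  subset_convexHull ℝ _ v.2

/-- The edge of `K` opposite to the vertex `u`. -/
def oppositeEdge (K : M.Element) (u : K.1) : M.Edge := by
  classical
  have hc : (K.1.erase u).card = 2 := by rw [Finset.card_erase_of_mem u.2, K.2.2]
  exact ⟨K.1.erase u, (M.complex.isRelLowerSet_faces K.2.1).2 (Finset.erase_subset _ _)
    (Finset.card_pos.1 (by omega)), hc⟩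

theorem mem_oppositeEdge {K : M.Element} {u v : K.1} :
    v.1 ∈ (M.oppositeEdge K u).1 ↔ v ≠ u := by
  classical
  exact Finset.mem_erase.trans ⟨fun h e => h.1 (congrArg Subtype.val e),
    fun h => ⟨fun e => h (Subtype.ext e), v.2⟩⟩

theorem oppositeEdge_subset (K : M.Element) (u : K.1) : (M.oppositeEdge K u).1 ⊆ K.1 := by
  classical exact Finset.erase_subset _ _

/-- Together with `exists_oppositeEdge_eq`, this lets sums over the edges of K be rewritten as sums
over its vertices. -/
theorem oppositeEdge_injective (K : M.Element) : Function.Injective (M.oppositeEdge K) := by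
  intro u v h
  by_contra hne
  have := M.mem_oppositeEdge.2 hne
  rw [← h] at this
  exact M.mem_oppositeEdge.1 this rfl

theorem exists_oppositeEdge_eq {K : M.Element} {F : M.Edge} (h : F.1 ⊆ K.1) :
    ∃ u, M.oppositeEdge K u = F := by
  classical
  obtain ⟨u, huK, huF⟩ : ∃ u ∈ K.1, u ∉ F.1 := by
    by_contra! hsub
    have := Finset.card_le_card hsub
    rw [K.2.2, F.2.2] at this
    omega
  refine ⟨⟨u, huK⟩, Subtype.ext (Finset.eq_of_subset_of_card_le ?_ ?_).symm⟩
  · exact fun v hv => Finset.mem_erase.2 ⟨fun e : v = u => huF (e ▸ hv), h hv⟩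
  · rw [F.2.2, (M.oppositeEdge K ⟨u, huK⟩).2.2]

theorem exists_element_of_edge (F : M.Edge) : ∃ K : M.Element, F.1 ⊆ K.1 := by
  obtain ⟨t, ht, hs, hc⟩ := M.pure F.1 F.2.1
  exact ⟨⟨t, ht, hc⟩, hs⟩

theorem baryOpp_oppositeEdge (K : M.Element) (u : K.1) (x : Plane) :
    M.baryOpp K (M.oppositeEdge K u) x = M.bary K u x := by
  rw [baryOpp, Finset.sum_eq_single u]
  · rw [if_neg (by rw [mem_oppositeEdge]; simp)]
  · intro v _ hv
    rw [if_pos (M.mem_oppositeEdge.2 hv)]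
  · simp

theorem ncBubbleLocal_of_not_subset {q : ℕ} {F : M.Edge} {K : M.Element} (h : ¬ F.1 ⊆ K.1)
    (x : Plane) : M.ncBubbleLocal q F K x = 0 := if_neg h

theorem ncBubbleLocal_one_oppositeEdge (K : M.Element) (u : K.1) (x : Plane) :
    M.ncBubbleLocal 1 (M.oppositeEdge K u) K x = 1 - 2 * M.bary K u x := by
  rw [ncBubbleLocal, if_pos (M.oppositeEdge_subset K u), eval_legendre_one,
    baryOpp_oppositeEdge]

/-- A modal edge function vanishes where the barycentric coordinate of one of the endpoints of
its edge does. -/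
theorem modalEdgeLocal_eq_zero (o : M.EdgeOrientation) {F : M.Edge} (j : ℕ) {K : M.Element}
    {x : Plane} {v : K.1} (hv : v.1 ∈ F.1) (h : M.bary K v x = 0) :
    M.modalEdgeLocal o F j K x = 0 := by
  unfold modalEdgeLocal
  split_ifs with hF
  · obtain ⟨i, hi⟩ := (o F).surjective ⟨v, hv⟩
    have hi' : (⟨o F i, hF (o F i).2⟩ : K.1) = v := Subtype.ext (by rw [hi])
    fin_cases i
    · simp only [Fin.zero_eta] at hi'
      rw [hi', h]; simp
    · simp only [Fin.mk_one] at hi'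
      rw [hi', h]; simp
  · rfl

/-- An element bubble vanishes on the boundary of its element. -/
theorem modalElementLocal_eq_zero (ν : M.VertexNumbering) (T : M.Element) (r₁ r₂ : ℕ)
    {K : M.Element} {x : Plane} {v : K.1} (h : M.bary K v x = 0) :
    M.modalElementLocal ν T r₁ r₂ K x = 0 := by
  unfold modalElementLocal
  split_ifs with hT
  · subst hT
    obtain ⟨i, rfl⟩ := (ν K).surjective v
    fin_cases i
    · simp only [Fin.zero_eta] at h
      rw [h]; simp
    · simp only [Fin.mk_one] at h
      rw [h]; simp
    · simp only [Fin.reduceFinMk] at h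
      rw [h]; simp
  · rfl

theorem modalElementLocal_of_ne (ν : M.VertexNumbering) {T K : M.Element} (h : K ≠ T)
    (r₁ r₂ : ℕ) (x : Plane) : M.modalElementLocal ν T r₁ r₂ K x = 0 := if_neg h

/-! ### Removing the three families: vertices, edges, interiors. -/

section Coefficients

variable {o : M.EdgeOrientation} {ν : M.VertexNumbering} {p : M.Element → ℕ}
  {a : M.Edge → ℝ} {b : ∀ F, M.EdgeModes p F → ℝ} {c : ∀ K, M.ElementModes p K → ℝ}

/-- The values at the vertices determine the coefficients of the linear bubbles. -/
theorem ncBubble_coeff_eq_zero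
    (h : ∀ K, ∀ x ∈ M.triangle K, ∑ F, a F * M.ncBubbleLocal 1 F K x
      + ∑ F, ∑ j, b F j * M.modalEdgeLocal o F j.1 K x
      + ∑ T, ∑ r, c T r * M.modalElementLocal ν T r.1.1 r.1.2 K x = 0) (F : M.Edge) :
    a F = 0 := by
  classical
  obtain ⟨K, hK⟩ := M.exists_element_of_edge F
  obtain ⟨w, rfl⟩ := M.exists_oppositeEdge_eq hK
  -- At v, the bubble of the edge opposite to u equals 1 if u ≠ v and -1 if u = v.
  have key (v : K.1) :
      ∑ u, a (M.oppositeEdge K u) - 2 * a (M.oppositeEdge K v) = 0 := by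
    have hv := h K v (M.vertex_mem_triangle K v)
    -- Any edge of K has an endpoint other than v, whose coordinate vanishes at v.
    have hedge (F : M.Edge) (j : ℕ) : M.modalEdgeLocal o F j K v = 0 := by
      by_cases hF : F.1 ⊆ K.1
      · obtain ⟨u, hu, huv⟩ := Finset.exists_mem_ne (by rw [F.2.2]; norm_num) v.1
        refine M.modalEdgeLocal_eq_zero o j (v := ⟨u, hF hu⟩) hu ?_
        rw [bary_vertex, if_neg fun e => huv (congrArg Subtype.val e)]
      · exact dif_neg hF
    have helem (T : M.Element) (r₁ r₂ : ℕ) : M.modalElementLocal ν T r₁ r₂ K v = 0 := by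
      obtain ⟨u, hu, huv⟩ := Finset.exists_mem_ne (by rw [K.2.2]; norm_num) v.1
      refine M.modalElementLocal_eq_zero ν T r₁ r₂ (v := ⟨u, hu⟩) ?_
      rw [bary_vertex, if_neg fun e => huv (congrArg Subtype.val e)]
    simp only [hedge, helem, mul_zero, Finset.sum_const_zero, add_zero] at hv
    rw [← Fintype.sum_of_injective (M.oppositeEdge K) (M.oppositeEdge_injective K)
      (fun u => a (M.oppositeEdge K u) * (1 - 2 * if u = v then 1 else 0))] at hv
    · rw [← hv]
      simp [mul_sub, Finset.sum_sub_distrib]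
      ring
    · intro F hF
      rw [M.ncBubbleLocal_of_not_subset (fun hs => hF (M.exists_oppositeEdge_eq hs)), mul_zero]
    · intro u
      rw [ncBubbleLocal_one_oppositeEdge, bary_vertex]
  -- Summing over the three vertices gives 3S - 2S = S = 0.
  have hsum : ∑ v, (∑ u, a (M.oppositeEdge K u) - 2 * a (M.oppositeEdge K v)) = 0 :=
    Finset.sum_eq_zero fun v _ => key v
  rw [Finset.sum_sub_distrib, ← Finset.mul_sum, Finset.sum_const, Finset.card_univ,
    Fintype.card_coe, K.2.2, nsmul_eq_mul] at hsum
  push_cast at hsum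
  linarith [key w]

/-- The values on an edge determine the coefficients of its modal functions. -/
theorem modalEdge_coeff_eq_zero
    (h : ∀ K, ∀ x ∈ M.triangle K, ∑ F, ∑ j, b F j * M.modalEdgeLocal o F j.1 K x
      + ∑ T, ∑ r, c T r * M.modalElementLocal ν T r.1.1 r.1.2 K x = 0) (F : M.Edge)
    (j : M.EdgeModes p F) : b F j = 0 := by
  classical
  obtain ⟨K, hK⟩ := M.exists_element_of_edge F
  obtain ⟨w, hw⟩ := M.exists_oppositeEdge_eq hK
  set u₀ : K.1 := ⟨o F 0, hK (o F 0).2⟩ with hu₀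
  set u₁ : K.1 := ⟨o F 1, hK (o F 1).2⟩ with hu₁
  have h01 : u₀ ≠ u₁ := fun e => by
    have := (o F).injective (Subtype.ext (congrArg (fun z : K.1 => z.1) e))
    exact absurd this (by decide)
  have h0w : u₀ ≠ w := M.mem_oppositeEdge.1 (hw ▸ (o F 0).2)
  have h1w : u₁ ≠ w := M.mem_oppositeEdge.1 (hw ▸ (o F 1).2)
  -- For j = 0 this would be a division by zero, with value 0; the bound 1 ≤ j excludes it.
  have hpos (j : M.EdgeModes p F) :
      8 * √(4 * (j.1 : ℕ) + 2) / ((j.1 : ℕ) * ((j.1 : ℕ) + 1)) ≠ 0 := by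
    have hj : (0 : ℝ) < (j.1 : ℕ) := by exact_mod_cast j.2
    positivity
  have hL : LinearIndependent ℝ fun j : M.EdgeModes p F => derivative (legendre j.1) := by
    have := linearIndependent_derivative_legendre.comp (fun j : M.EdgeModes p F => (j.1 : ℕ) - 1)
      (fun i j hij => Subtype.ext (Fin.ext (by
        have := i.2; have := j.2; simp only at hij; omega)))
    convert this using 2 with j
    simp [Nat.sub_add_cancel j.2]
  refine (mul_eq_zero.1 (eq_zero_of_sum_mul_eval_eq_zero hL
    (c := fun j => b F j * (8 * √(4 * (j.1 : ℕ) + 2) / ((j.1 : ℕ) * ((j.1 : ℕ) + 1))))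
    (s := Set.Ioo (-1) 1) (Set.Ioo_infinite (by norm_num)) (fun t ht => ?_) j)).resolve_right
    (hpos j)
  have huniv : (Finset.univ : Finset K.1) = {u₀, u₁, w} := by
    refine (Finset.eq_univ_of_card _ ?_).symm
    rw [Finset.card_eq_three.2 ⟨u₀, u₁, w, h01, h0w, h1w, rfl⟩, Fintype.card_coe, K.2.2]
  -- The point of F at parameter t, where -λ_a + λ_b = t and the coordinate opposite to F is 0.
  obtain ⟨x, hx⟩ := M.exists_bary_eq K
    (w := fun v => if v = u₀ then (1 - t) / 2 else if v = u₁ then (1 + t) / 2 else 0) (by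
      rw [huniv, Finset.sum_insert (by simp [h01, h0w]), Finset.sum_pair h1w]
      simp [h01.symm, h0w.symm, h1w.symm]
      ring)
  have hx0 : M.bary K u₀ x = (1 - t) / 2 := by simp [hx]
  have hx1 : M.bary K u₁ x = (1 + t) / 2 := by simp [hx, h01.symm]
  have hxw : M.bary K w x = 0 := by simp [hx, h0w.symm, h1w.symm]
  have hxK : x ∈ M.triangle K := by
    refine M.mem_triangle_iff.2 fun v => ?_
    rw [hx]
    split_ifs <;> linarith [ht.1, ht.2]
  have hsum := h K x hxK
  simp only [M.modalElementLocal_eq_zero ν _ _ _ hxw, mul_zero, Finset.sum_const_zero,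
    add_zero] at hsum
  rw [Finset.sum_eq_single F] at hsum
  · have hne : (1 - t) / 2 * ((1 + t) / 2) ≠ 0 :=
      mul_ne_zero (by linarith [ht.2]) (by linarith [ht.1])
    refine (mul_eq_zero.1 ?_).resolve_left hne
    rw [← hsum, Finset.mul_sum]
    refine Finset.sum_congr rfl fun j _ => ?_
    rw [modalEdgeLocal, dif_pos hK, ← hu₀, ← hu₁, hx0, hx1,
      show -((1 - t) / 2) + (1 + t) / 2 = t by ring]
    ring
  · intro F' _ hF'
    refine Finset.sum_eq_zero fun j _ => ?_
    rw [mul_eq_zero]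
    right
    -- Another edge of K has w as an endpoint, and the coordinate at w vanishes on F.
    by_cases hsub : F'.1 ⊆ K.1
    · obtain ⟨u, rfl⟩ := M.exists_oppositeEdge_eq hsub
      refine M.modalEdgeLocal_eq_zero o _ (M.mem_oppositeEdge.2 ?_) hxw
      rintro rfl
      exact hF' hw
    · exact dif_neg hsub
  · simp

/-- The element bubbles are linearly independent on their element. -/
theorem modalElement_coeff_eq_zero
    (h : ∀ K, ∀ x ∈ M.triangle K,
      ∑ T, ∑ r, c T r * M.modalElementLocal ν T r.1.1 r.1.2 K x = 0) (K : M.Element)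
    (r : M.ElementModes p K) : c K r = 0 := by
  classical
  -- Extension of the coefficients by zero from the admissible pairs to a full square, as needed for
  -- tensor products.
  let d (i j : Fin (p K)) : ℝ :=
    if hr : (i : ℕ) + j + 3 ≤ p K then c K ⟨(i, j), hr⟩ else 0
  have hd : d r.1.1 r.1.2 = c K r := dif_pos r.2
  rw [← hd]
  refine eq_zero_of_sum_mul_legendre_mul_legendre (fun s hs t ht => ?_) _ _
  -- These weights solve λ₂ - λ₁ = t and λ₃ = s; all are positive exactly when s > 0 and |t| < 1 -
  -- s.
  obtain ⟨x, hx⟩ := M.exists_bary_eq K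
    (w := fun v => ![(1 - s - t) / 2, (1 - s + t) / 2, s] ((ν K).symm v)) (by
      rw [Equiv.sum_comp (ν K).symm fun i => ![(1 - s - t) / 2, (1 - s + t) / 2, s] i,
        Fin.sum_univ_three]
      simp
      ring)
  have hx0 : M.bary K (ν K 0) x = (1 - s - t) / 2 := by simp [hx]
  have hx1 : M.bary K (ν K 1) x = (1 - s + t) / 2 := by simp [hx]
  have hx2 : M.bary K (ν K 2) x = s := by simp [hx]
  have h0 : 0 < (1 - s - t) / 2 := by linarith [ht.2]
  have h1 : 0 < (1 - s + t) / 2 := by linarith [ht.1]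
  have hxK : x ∈ M.triangle K := by
    refine M.mem_triangle_iff.2 fun v => ?_
    obtain ⟨i, rfl⟩ := (ν K).surjective v
    fin_cases i
    · exact hx0 ▸ h0.le
    · exact hx1 ▸ h1.le
    · exact hx2 ▸ hs.1.le
  have hsum := h K x hxK
  rw [Finset.sum_eq_single K (fun T _ hT => Finset.sum_eq_zero fun r _ => by
    rw [M.modalElementLocal_of_ne ν hT.symm, mul_zero]) (by simp)] at hsum
  have hne : (1 - s - t) / 2 * ((1 - s + t) / 2) * s ≠ 0 :=
    mul_ne_zero (mul_pos h0 h1).ne' hs.1.ne'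
  refine (mul_eq_zero.1 ?_).resolve_left hne
  rw [← hsum, ← Fintype.sum_prod_type', Finset.mul_sum]
  symm
  refine Fintype.sum_of_injective Subtype.val Subtype.val_injective _ _ ?_ ?_
  · intro r hr
    have : d r.1 r.2 = 0 := dif_neg fun hr' => hr ⟨⟨r, hr'⟩, rfl⟩
    rw [this, zero_mul, mul_zero]
  · intro r
    have : d r.1.1 r.1.2 = c K r := dif_pos r.2
    rw [this, modalElementLocal, if_pos rfl, hx0, hx1, hx2,
      show (1 - s + t) / 2 - (1 - s - t) / 2 = t by ring]
    ring

end Coefficients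

/-! ### Assembly. -/

theorem linearIndependent_spanFamily (hΩ : IsOpen Ω) (o : M.EdgeOrientation)
    (ν : M.VertexNumbering) (p : M.Element → ℕ) :
    LinearIndependent ℝ (M.spanFamily o ν p) := by
  rw [← linearIndependent_equiv (M.spanIndexEquiv p), Fintype.linearIndependent_iff]
  intro g hg
  have hloc : ∀ K, ∀ x ∈ M.triangle K,
      ∑ i, g i * M.spanLocal o ν p (M.spanIndexEquiv p i) K x = 0 := by
    intro K x hx
    -- Linearity gathers the relation in L²(Ω) into a single element-wise continuous function.
    have h0 : M.brokenLinearMap (∑ i, g i • M.spanLocal o ν p (M.spanIndexEquiv p i)) = 0 := by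
      simpa [map_sum, brokenLinearMap_spanLocal] using hg
    simpa using M.brokenLinearMap_eq_zero hΩ h0 K hx
  simp only [Fintype.sum_sum_type, Fintype.sum_sigma] at hloc
  have ha := M.ncBubble_coeff_eq_zero (o := o) (ν := ν) (p := p)
    (a := fun F => g (.inl (.inl F))) (b := fun F j => g (.inl (.inr ⟨F, j⟩)))
    (c := fun K r => g (.inr ⟨K, r⟩)) hloc
  simp only [ha, zero_mul, Finset.sum_const_zero, zero_add] at hloc
  have hb := M.modalEdge_coeff_eq_zero (o := o) (ν := ν) (p := p)
    (b := fun F j => g (.inl (.inr ⟨F, j⟩))) (c := fun K r => g (.inr ⟨K, r⟩)) hloc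
  simp only [hb, zero_mul, Finset.sum_const_zero, zero_add] at hloc
  have hc := M.modalElement_coeff_eq_zero (ν := ν) (p := p)
    (c := fun K r => g (.inr ⟨K, r⟩)) hloc
  rintro ((F | ⟨F, j⟩) | ⟨K, r⟩)
  · exact ha F
  · exact hb F j
  · exact hc K r

end Mesh

end CR

end

theorem lemma4p1 {Ω : Set CR.Plane} (hΩ : IsOpen Ω) (M : CR.Mesh Ω)
    (o : M.EdgeOrientation) (ν : M.VertexNumbering) (p : M.Element → ℕ) :
    LinearIndependent ℝ (M.spanFamily o ν p) ∧
      ∃ b : Module.Basis (M.SpanIndex p) ℝ (M.variableCRSpace o ν p),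
        ∀ i, (b i : MeasureTheory.Lp ℝ 2 (MeasureTheory.volume.restrict Ω)) =
          M.spanFamily o ν p i := by
  have h := M.linearIndependent_spanFamily hΩ o ν p
  exact ⟨h, Module.Basis.span h, fun i => congrArg Subtype.val (Module.Basis.span_apply h i)⟩
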